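/- Let $\mathsf k$ be a field, let $d\ge 1$ and $k\ge 1$ be integers, put $j=2d+k-3$, and assume that $\operatorname{char}\mathsf k$ is $0$ or greater than $j$. Let $$T=(1,2,\ldots,d-1,\underbrace{d,\ldots,d}_{k},d-1,\ldots,2,1),$$ indexed by the degrees $0,1,\ldots,j$ (so $T_i=i+1$ for $0\le i\le d-1$, $T_i=d$ for $d-1\le i\le d+k-2$, $T_i=2d+k-2-i$ for $d+k-2\le i\le j$, and $T_i=0$ for $i>j$); these are the Hilbert functions of graded Artinian complete intersection quotients of $\mathsf k[x,y]$. A partition $P$ has diagonal lengths $T$ if, for each $i\ge 0$, its Ferrers diagram has exactly $T_i$ cells whose row and column indices (both counted from $0$) add up to $i$. A partition $P$ is a complete intersection Jordan type (CIJT) if there are an ideal $I\subset\mathsf k[x,y]$ generated by a regular sequence of two homogeneous polynomials and a nonzero linear form $\ell\in\mathsf k[x,y]_1$ such that the parts of $P$ are the sizes of the Jordan blocks of the (nilpotent) multiplication by $\ell$ on $\mathsf k[x,y]/I$. Then the number of CIJT partitions having diagonal lengths $T$ is exactly $2^d$ if $k>1$, and exactly $2^{d-1}$ if $k=1$. -/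

import Mathlib

/-- The sequence `T(d,k) = (1, 2, …, d-1, d, …, d, d-1, …, 2, 1, 0, 0, …)`, indexed by degree:
the value `d` is taken exactly in the `k` degrees `d-1, …, d+k-2`, and the last nonzero value
is `1`, in degree `2d+k-3`. (Meant for `1 ≤ d` and `1 ≤ k`; the truncated subtraction gives the
zeros in degrees `≥ 2d+k-2`.) -/
def ciHilbertFunction (d k : ℕ) (i : ℕ) : ℕ :=
  if i < d then i + 1 else if i < d + k - 1 then d else 2 * d + k - 2 - i

/-- The diagonal lengths of a partition, given by its Ferrers diagram `P`: the `i`-th one is the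
number of cells `(row, column)` with `row + column = i`. -/
def diagonalLengths (P : YoungDiagram) (i : ℕ) : ℕ :=
  (P.cells.filter (fun c => c.1 + c.2 = i)).card

/-- The linear map `φ` is nilpotent with Jordan block decomposition given by the partition `P`:
there is a basis indexed by the cells of the Ferrers diagram of `P`, such that each row is a
Jordan string: `φ` sends the basis vector of a cell to the one of the next cell in the same row,
and the basis vector of the last cell of a row to zero. So the parts of `P` (its row lengths)
are the sizes of the Jordan blocks. -/
def HasJordanType {K V : Type*} [Field K] [AddCommGroup V] [Module K V]
    (φ : V →ₗ[K] V) (P : YoungDiagram) : Prop :=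
  ∃ b : Module.Basis P.cells K V, ∀ c : P.cells,
    φ (b c) = if h : (c.1.1, c.1.2 + 1) ∈ P.cells then b ⟨(c.1.1, c.1.2 + 1), h⟩ else 0

/-- The ideal `I` of `K[x,y]` defines a graded Artinian complete intersection quotient: it is
generated by a regular sequence of two homogeneous polynomials. -/
def IsGradedCompleteIntersection {K : Type*} [Field K] (I : Ideal (MvPolynomial (Fin 2) K)) :
    Prop :=
  ∃ (f g : MvPolynomial (Fin 2) K) (a b : ℕ), f.IsHomogeneous a ∧ g.IsHomogeneous b ∧
    RingTheory.Sequence.IsRegular (MvPolynomial (Fin 2) K) [f, g] ∧ I = Ideal.span {f, g}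

/-- The partition `P` is a complete intersection Jordan type over `K`: it is the Jordan type of
the multiplication by some (nonzero) linear form on some graded complete intersection quotient
of `K[x,y]`. -/
def IsCIJT (K : Type*) [Field K] (P : YoungDiagram) : Prop :=
  ∃ (I : Ideal (MvPolynomial (Fin 2) K)) (l : MvPolynomial (Fin 2) K),
    IsGradedCompleteIntersection I ∧ l.IsHomogeneous 1 ∧ l ≠ 0 ∧
    HasJordanType (LinearMap.mulLeft K (Ideal.Quotient.mk I l)) P

/-! Write x, y for the variables. A linear change of coordinates turns ℓ into y, and I = (f, g) with
f, g coprime forms of degrees m, e and y ∤ f. Setting y = 1 gives coprime polynomials φ of degree m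
and γ, where γ may be assumed of degree less than both m and e.

A form of degree n lies in I exactly when its dehomogenization is uφ + vγ with v = 0 or deg v ≤ n -
e. For each i < m choose a monic combination w_i of degree i whose cofactor v has least degree. Then
y^c times the homogenization of w_i lies in I exactly when i + c ≥ deg v + e. The products outside I
form a Jordan basis for y, with a string of length deg v + e - i for each i
(`hasJordanType_of_combinations`).

The Euclidean algorithm computes this least degree: it is m + i - s - t, where s ≤ i < t are
consecutive among 0, the divisor degrees S, and m (`EuclidDegrees.exists_combination`,
`EuclidDegrees.le_natDegree_cofactor`). The Jordan type is therefore `layeredDiagram S m e`. Running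
the algorithm backwards realizes every S below m and e, which gives `isCIJT_iff`.

The diagonal lengths of this diagram do not depend on S, and T forces {m, e} = {d, d + k - 1}. So S
is any subset of {1, ..., d - 1}, and the diagram determines m and S. The count is 2^(d-1) times the
number of distinct values among d and d + k - 1. -/

/-- The largest element of `S ∪ {0}` which is at most `i`. -/
def blockStart (S : Finset ℕ) (i : ℕ) : ℕ := (S.filter (· ≤ i)).sup id

/-- The smallest element of `S ∪ {m}` which is greater than `i`. -/
noncomputable def blockEnd (S : Finset ℕ) (m i : ℕ) : ℕ := sInf {t | i < t ∧ (t ∈ S ∨ t = m)}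

/-! ### Intervals cut out of [0, m) by a finite set. -/

section Blocks

variable {S : Finset ℕ} {m i t a b : ℕ}

theorem blockStart_le : blockStart S i ≤ i :=
  Finset.sup_le fun _ ht => (Finset.mem_filter.1 ht).2

theorem le_blockStart (ht : t ∈ S) (hti : t ≤ i) : t ≤ blockStart S i :=
  Finset.le_sup (f := id) (Finset.mem_filter.2 ⟨ht, hti⟩)

theorem blockStart_mem : blockStart S i = 0 ∨ blockStart S i ∈ S := by
  rcases (S.filter (· ≤ i)).eq_empty_or_nonempty with h | h
  · left; simp [blockStart, h]
  · right
    obtain ⟨t, ht, h'⟩ := Finset.exists_mem_eq_sup _ h id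
    rw [blockStart, h']
    exact (Finset.mem_filter.1 ht).1

theorem blockStart_eq (ha : a = 0 ∨ a ∈ S) (hai : a ≤ i) (h : ∀ t ∈ S, t ≤ i → t ≤ a) :
    blockStart S i = a := by
  refine le_antisymm (Finset.sup_le fun t ht => ?_) ?_
  · exact h t (Finset.mem_filter.1 ht).1 (Finset.mem_filter.1 ht).2
  · rcases ha with rfl | ha
    · exact Nat.zero_le _
    · exact le_blockStart ha hai

theorem blockEnd_spec (hi : i < m) :
    i < blockEnd S m i ∧ (blockEnd S m i ∈ S ∨ blockEnd S m i = m) :=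
  Nat.sInf_mem (s := {t | i < t ∧ (t ∈ S ∨ t = m)}) ⟨m, hi, Or.inr rfl⟩

theorem blockEnd_le (ht : t ∈ S) (hti : i < t) : blockEnd S m i ≤ t :=
  Nat.sInf_le ⟨hti, Or.inl ht⟩

theorem blockEnd_le_self (hi : i < m) : blockEnd S m i ≤ m := Nat.sInf_le ⟨hi, Or.inr rfl⟩

theorem blockEnd_eq (hb : b ∈ S ∨ b = m) (hib : i < b) (hbm : b ≤ m) (h : ∀ t ∈ S, i < t → b ≤ t) :
    blockEnd S m i = b := by
  refine le_antisymm (Nat.sInf_le ⟨hib, hb⟩) ?_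
  obtain ⟨h1, h2 | h2⟩ := blockEnd_spec (S := S) (lt_of_lt_of_le hib hbm)
  · exact h _ h2 h1
  · rw [h2]; exact hbm

theorem blockStart_mono {i' : ℕ} (h : i ≤ i') : blockStart S i ≤ blockStart S i' :=
  Finset.sup_mono fun t ht => by
    rw [Finset.mem_filter] at ht ⊢
    exact ⟨ht.1, ht.2.trans h⟩

theorem blockEnd_mono {i' : ℕ} (h : i ≤ i') (hi' : i' < m) : blockEnd S m i ≤ blockEnd S m i' :=
  Nat.sInf_le ⟨h.trans_lt (blockEnd_spec hi').1, (blockEnd_spec hi').2⟩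

/-- The reversal of each block is an involution compatible with the blocks. -/
theorem block_reflect (hi : i < m) (ht : t + i + 1 = blockStart S i + blockEnd S m i) :
    t < m ∧ blockStart S t = blockStart S i ∧ blockEnd S m t = blockEnd S m i := by
  have h1 := blockStart_le (S := S) (i := i)
  have h2 := blockEnd_spec (S := S) hi
  have h3 := blockEnd_le_self (S := S) hi
  refine ⟨by omega, blockStart_eq blockStart_mem (by omega) fun s hs hst => ?_,
    blockEnd_eq h2.2 (by omega) h3 fun s hs hst => ?_⟩
  · by_contra hcon
    have : i < s := by
      by_contra h
      exact hcon (le_blockStart hs (by omega))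
    have := blockEnd_le (m := m) hs this
    omega
  · by_contra hcon
    have : s ≤ i := by
      by_contra h
      exact hcon (blockEnd_le hs (by omega))
    have := le_blockStart hs this
    omega

end Blocks

/-! ### Layered diagrams and their diagonal lengths. -/

/-- The partition with `m` rows, of lengths `m + e - s - t` for the rows in the block `[s, t)`,
where the blocks are the intervals into which `S` cuts `[0, m)`. -/
noncomputable def layeredDiagram (S : Finset ℕ) (m e : ℕ) : YoungDiagram where
  cells := (Finset.range m ×ˢ Finset.range (m + e)).filter
    fun c => c.2 < m + e - (blockStart S c.1 + blockEnd S m c.1)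
  isLowerSet := by
    rintro ⟨i, c⟩ ⟨i', c'⟩ ⟨h1, h2⟩ h
    simp only [Finset.coe_filter, Finset.mem_product, Finset.mem_range, Set.mem_ofPred_eq] at h h1 h2 ⊢
    have := blockStart_mono (S := S) h1
    have := blockEnd_mono (S := S) h1 h.1.1
    omega

section LayeredDiagram

variable {S : Finset ℕ} {m e : ℕ}

theorem mem_layeredDiagram {i c : ℕ} : (i, c) ∈ (layeredDiagram S m e).cells ↔
    i < m ∧ c < m + e - (blockStart S i + blockEnd S m i) := by
  simp only [layeredDiagram, Finset.mem_filter, Finset.mem_product, Finset.mem_range]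
  omega

theorem blockStart_add_blockEnd_lt (he : 0 < e) (hSe : ∀ t ∈ S, t < e) {i : ℕ} (hi : i < m) :
    blockStart S i + blockEnd S m i < m + e := by
  have h1 : blockStart S i < e := by
    rcases blockStart_mem (S := S) (i := i) with h | h
    · omega
    · exact hSe _ h
  have h2 := blockEnd_le_self (S := S) hi
  omega

theorem card_filter_range_le (m n : ℕ) : ((Finset.range m).filter (· ≤ n)).card = min (n + 1) m := by
  have : (Finset.range m).filter (· ≤ n) = Finset.range (min (n + 1) m) := by
    ext t; simp; omega
  rw [this, Finset.card_range]

theorem card_filter_range_ge (m n : ℕ) : ((Finset.range m).filter (n ≤ ·)).card = m - n := by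
  have : (Finset.range m).filter (n ≤ ·) = Finset.Ico n m := by
    ext t; simp; omega
  rw [this, Nat.card_Ico]

/-- Row i meets diagonal n unless n < i or the row has ended, that is i + p_i ≤ n with p_i its
length. For i in the block [s, t), the reflection i' = s + t - 1 - i gives i + p_i = m + e - 1 - i',
so the number of ended rows is the number of i' ≥ m + e - 1 - n, whatever S is. -/
theorem diagonalLengths_layeredDiagram (he : 0 < e) (hSe : ∀ t ∈ S, t < e) (n : ℕ) :
    diagonalLengths (layeredDiagram S m e) n = min (n + 1) m - (m - (m + e - 1 - n)) := by
  have key := fun i (hi : i < m) => blockStart_add_blockEnd_lt he hSe hi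
  have h1 : diagonalLengths (layeredDiagram S m e) n = (((Finset.range m).filter (· ≤ n)) \
      ((Finset.range m).filter
        fun i => i + (m + e - (blockStart S i + blockEnd S m i)) ≤ n)).card := by
    refine Finset.card_bij' (fun c _ => c.1) (fun i _ => (i, n - i)) ?_ ?_ ?_ ?_
    · rintro ⟨i, c⟩ h
      rw [Finset.mem_filter, mem_layeredDiagram] at h
      simp only [Finset.mem_sdiff, Finset.mem_filter, Finset.mem_range]
      omega
    · intro i h
      simp only [Finset.mem_sdiff, Finset.mem_filter, Finset.mem_range] at h
      rw [Finset.mem_filter, mem_layeredDiagram]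
      dsimp only
      omega
    · rintro ⟨i, c⟩ h
      rw [Finset.mem_filter] at h
      ext <;> dsimp only at h ⊢
      omega
    · intro i _; rfl
  have h2 : ((Finset.range m).filter
        fun i => i + (m + e - (blockStart S i + blockEnd S m i)) ≤ n).card
      = ((Finset.range m).filter (m + e - 1 - n ≤ ·)).card := by
    have refl : ∀ i < m, (blockStart S i + blockEnd S m i - 1 - i) + i + 1 =
        blockStart S i + blockEnd S m i := fun i hi => by
      have := (blockEnd_spec (S := S) hi).1
      omega
    refine Finset.card_bij' (fun i _ => blockStart S i + blockEnd S m i - 1 - i)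
      (fun i _ => blockStart S i + blockEnd S m i - 1 - i) ?_ ?_ ?_ ?_
    · intro i h
      rw [Finset.mem_filter, Finset.mem_range] at h ⊢
      have := block_reflect h.1 (refl i h.1)
      have := key i h.1
      omega
    · intro i h
      rw [Finset.mem_filter, Finset.mem_range] at h ⊢
      obtain ⟨h1, h2, h3⟩ := block_reflect h.1 (refl i h.1)
      have := key i h.1
      have := refl i h.1
      rw [h2, h3]
      omega
    · intro i h
      rw [Finset.mem_filter, Finset.mem_range] at h
      obtain ⟨h1, h2, h3⟩ := block_reflect h.1 (refl i h.1)
      have := refl i h.1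
      rw [h2, h3]
      omega
    · intro i h
      rw [Finset.mem_filter, Finset.mem_range] at h
      obtain ⟨h1, h2, h3⟩ := block_reflect h.1 (refl i h.1)
      have := refl i h.1
      rw [h2, h3]
      omega
  rw [h1, Finset.card_sdiff_of_subset, h2, card_filter_range_le, card_filter_range_ge]
  intro i h
  rw [Finset.mem_filter] at h ⊢
  exact ⟨h.1, by omega⟩

theorem ciHilbertFunction_pred {d k : ℕ} (hd : 1 ≤ d) : ciHilbertFunction d k (d - 1) = d := by
  rw [ciHilbertFunction, if_pos (by omega)]
  omega

theorem ciHilbertFunction_self_le {d k : ℕ} (hk : 1 ≤ k) : ciHilbertFunction d k d ≤ d := by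
  rw [ciHilbertFunction, if_neg (by omega)]
  split_ifs <;> omega

theorem ciHilbertFunction_socle {d k : ℕ} (hd : 1 ≤ d) (hk : 1 ≤ k) :
    1 ≤ ciHilbertFunction d k (2 * d + k - 3) := by
  rw [ciHilbertFunction]
  split_ifs <;> omega

theorem ciHilbertFunction_eq_zero {d k : ℕ} (hd : 1 ≤ d) (hk : 1 ≤ k) :
    ciHilbertFunction d k (2 * d + k - 2) = 0 := by
  rw [ciHilbertFunction, if_neg (by omega), if_neg (by omega)]
  omega

/-- Four values of T suffice: the value d in degree d - 1 gives d ≤ m and d ≤ e, the value at most d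
in degree d makes one of them equal d, and the last nonzero degree fixes m + e. -/
theorem diagonalLengths_layeredDiagram_eq_iff {d k : ℕ} (hd : 1 ≤ d) (hk : 1 ≤ k)
    (he : 0 < e) (hSe : ∀ t ∈ S, t < e) :
    diagonalLengths (layeredDiagram S m e) = ciHilbertFunction d k ↔
      (m = d ∧ e = d + k - 1) ∨ (m = d + k - 1 ∧ e = d) := by
  have key := diagonalLengths_layeredDiagram (m := m) he hSe
  constructor
  · intro h
    have h1 := ciHilbertFunction_pred (k := k) hd
    have h2 := ciHilbertFunction_self_le (d := d) hk
    have h3 := ciHilbertFunction_socle hd hk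
    have h4 := ciHilbertFunction_eq_zero hd hk
    rw [← h, key] at h1 h2 h3 h4
    clear h key
    have h5 : d ≤ m ∧ d ≤ e := by omega
    have h6 : m = d ∨ e = d := by omega
    omega
  · intro h
    ext n
    rw [key, ciHilbertFunction]
    clear key
    rcases h with ⟨rfl, rfl⟩ | ⟨rfl, rfl⟩ <;> split_ifs <;> omega

theorem rows_layeredDiagram (he : 0 < e) (hSe : ∀ t ∈ S, t < e) {i : ℕ} :
    (i, 0) ∈ (layeredDiagram S m e).cells ↔ i < m := by
  rw [mem_layeredDiagram]
  refine ⟨fun h => h.1, fun h => ⟨h, ?_⟩⟩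
  have := blockStart_add_blockEnd_lt he hSe h
  omega

/-- The elements of `S` are the positions of the descents of the row lengths. -/
theorem mem_iff_layeredDiagram_descent (he : 0 < e) (hSe : ∀ t ∈ S, t < e) {i : ℕ} (hi : i + 1 < m) :
    i + 1 ∈ S ↔ ∃ c, (i, c) ∈ (layeredDiagram S m e).cells ∧
      (i + 1, c) ∉ (layeredDiagram S m e).cells := by
  simp only [mem_layeredDiagram]
  have h0 := blockStart_add_blockEnd_lt he hSe (m := m) (i := i) (by omega)
  have h1 := blockStart_add_blockEnd_lt he hSe hi
  constructor
  · intro h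
    have h2 : blockStart S (i + 1) = i + 1 := blockStart_eq (Or.inr h) le_rfl fun _ _ h => h
    have h3 := blockStart_le (S := S) (i := i)
    have h4 : blockEnd S m i ≤ blockEnd S m (i + 1) := blockEnd_mono (by omega) hi
    -- The block start jumps up and the block end does not decrease, so row i + 1 is shorter; its
    -- length is the first column it misses.
    exact ⟨m + e - (blockStart S (i + 1) + blockEnd S m (i + 1)), by omega, by omega⟩
  · rintro ⟨c, hc, hc'⟩
    by_contra hcon
    have h2 : blockStart S (i + 1) = blockStart S i := by
      refine blockStart_eq blockStart_mem (blockStart_le.trans (by omega)) fun t ht hti =>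
        le_blockStart ht ?_
      have : t ≠ i + 1 := fun h => hcon (h ▸ ht)
      omega
    have h3 : blockEnd S m (i + 1) = blockEnd S m i := by
      have := blockEnd_spec (S := S) (m := m) (i := i) (by omega)
      refine blockEnd_eq this.2 ?_ (blockEnd_le_self (Nat.lt_of_succ_lt hi)) fun t ht hti =>
        blockEnd_le ht (lt_of_le_of_lt (Nat.le_succ i) hti)
      have h5 : blockEnd S m i ≠ i + 1 := fun h => by
        rcases this.2 with h' | h'
        · exact hcon (h ▸ h')
        · omega
      omega
    rw [h2, h3] at hc'
    omega

end LayeredDiagram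

/-! ### Euclidean algorithm and minimal cofactor degrees. -/

section Euclid

open Polynomial

variable {K : Type*} [Field K]

/-- `S` is the set of positive degrees of the divisors which occur in the Euclidean algorithm for
the coprime polynomials `φ`, `γ`, where `γ` is the first divisor. -/
inductive EuclidDegrees : Finset ℕ → K[X] → K[X] → Prop
  | unit (φ γ : K[X]) (hφ : 0 < φ.natDegree) (hγ : IsUnit γ) : EuclidDegrees ∅ φ γ
  | step (S : Finset ℕ) (γ ρ q : K[X]) (h : EuclidDegrees S γ ρ) (hq : 0 < q.natDegree) :
      EuclidDegrees (insert γ.natDegree S) (q * γ + ρ) γ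

theorem natDegree_mul_add_of_lt {q γ ρ : K[X]} (hq : 0 < q.natDegree)
    (h : ρ.natDegree < γ.natDegree) :
    (q * γ + ρ).natDegree = q.natDegree + γ.natDegree := by
  have hq0 : q ≠ 0 := by rintro rfl; simp at hq
  have hγ0 : γ ≠ 0 := by rintro rfl; simp at h
  rw [natDegree_add_eq_left_of_natDegree_lt, natDegree_mul hq0 hγ0]
  rw [natDegree_mul hq0 hγ0]
  omega

namespace EuclidDegrees

variable {S : Finset ℕ} {φ γ : K[X]}

theorem natDegree_lt (h : EuclidDegrees S φ γ) : γ.natDegree < φ.natDegree := by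
  induction h with
  | unit φ γ hφ hγ => rwa [natDegree_eq_zero_of_isUnit hγ]
  | step S γ ρ q h hq ih => rw [natDegree_mul_add_of_lt hq ih]; omega

theorem isCoprime (h : EuclidDegrees S φ γ) : IsCoprime φ γ := by
  induction h with
  | unit φ γ hφ hγ =>
    obtain ⟨u, rfl⟩ := hγ
    exact ⟨0, ↑u⁻¹, by simp⟩
  | step S γ ρ q h hq ih =>
    rw [add_comm]
    exact (IsCoprime.add_mul_right_left_iff (z := q)).2 ih.symm

theorem le_natDegree (h : EuclidDegrees S φ γ) : ∀ t ∈ S, t ≤ γ.natDegree := by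
  induction h with
  | unit φ γ hφ hγ => simp
  | step S γ ρ q h hq ih =>
    intro t ht
    rcases Finset.mem_insert.1 ht with rfl | ht
    · exact le_rfl
    · exact (ih t ht).trans h.natDegree_lt.le

theorem pos (h : EuclidDegrees S φ γ) : ∀ t ∈ S, 0 < t := by
  induction h with
  | unit φ γ hφ hγ => simp
  | step S γ ρ q h hq ih =>
    intro t ht
    rcases Finset.mem_insert.1 ht with rfl | ht
    · exact (Nat.zero_le _).trans_lt h.natDegree_lt
    · exact ih t ht

theorem natDegree_mem (h : EuclidDegrees S φ γ) : γ.natDegree = 0 ∨ γ.natDegree ∈ S := by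
  cases h with
  | unit φ γ hφ hγ => exact Or.inl (natDegree_eq_zero_of_isUnit hγ)
  | step S γ ρ q h hq => exact Or.inr (Finset.mem_insert_self _ _)

theorem ne_zero (h : EuclidDegrees S φ γ) : γ ≠ 0 := by
  cases h with
  | unit φ γ hφ hγ => exact hγ.ne_zero
  | step S γ ρ q h hq => rintro rfl; simpa using h.natDegree_lt

end EuclidDegrees

theorem exists_euclidDegrees (γ φ : K[X]) (hlt : γ.natDegree < φ.natDegree) (hco : IsCoprime φ γ) :
    ∃ S, EuclidDegrees S φ γ := by
  induction h : γ.natDegree using Nat.strong_induction_on generalizing γ φ with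
  | _ n ih =>
    subst h
    have hγ0 : γ ≠ 0 := by
      rintro rfl
      rw [isCoprime_zero_right] at hco
      rw [natDegree_eq_zero_of_isUnit hco] at hlt
      omega
    rcases Nat.eq_zero_or_pos γ.natDegree with h0 | hpos
    · refine ⟨∅, .unit φ γ (by omega) ?_⟩
      rw [eq_C_of_natDegree_eq_zero h0, isUnit_C, isUnit_iff_ne_zero]
      rintro h1
      exact hγ0 (by rw [eq_C_of_natDegree_eq_zero h0, h1, C_0])
    · have hdiv : φ / γ * γ + φ % γ = φ := by rw [mul_comm]; exact EuclideanDomain.div_add_mod φ γ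
      have hmod : (φ % γ).natDegree < γ.natDegree := natDegree_mod_lt _ hpos.ne'
      have hq : 0 < (φ / γ).natDegree := by
        have h1 := natDegree_add_le (φ / γ * γ) (φ % γ)
        have h2 := natDegree_mul_le (p := φ / γ) (q := γ)
        rw [hdiv] at h1
        omega
      obtain ⟨S, hS⟩ := ih _ hmod (φ % γ) γ hmod (by
        rw [← hdiv, add_comm] at hco
        exact ((IsCoprime.add_mul_right_left_iff (z := φ / γ)).1 hco).symm) rfl
      refine ⟨insert γ.natDegree S, ?_⟩
      have := EuclidDegrees.step S γ (φ % γ) (φ / γ) hS hq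
      rwa [hdiv] at this

variable (K) in
-- The algorithm is run backwards: the largest element s of S becomes the degree of the first
-- divisor, and X^(m - s) serves as quotient.
theorem exists_polynomials_of_degrees (S : Finset ℕ) (hpos : ∀ t ∈ S, 0 < t) :
    ∀ m, 0 < m → (∀ t ∈ S, t < m) → ∃ φ γ : K[X], φ.natDegree = m ∧ EuclidDegrees S φ γ := by
  induction S using Finset.induction_on_max with
  | empty =>
    intro m hm _
    exact ⟨X ^ m, 1, natDegree_X_pow m, .unit _ _ (by simpa) isUnit_one⟩
  | insert s S hs ih =>
    intro m hm hSm
    obtain ⟨γ, ρ, hγ, h⟩ := ih (fun t ht => hpos t (Finset.mem_insert_of_mem ht)) s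
      (hpos s (Finset.mem_insert_self _ _)) hs
    have hsm := hSm s (Finset.mem_insert_self _ _)
    subst hγ
    set s := γ.natDegree
    have hq : 0 < (X ^ (m - s) : K[X]).natDegree := by rw [natDegree_X_pow]; omega
    refine ⟨X ^ (m - s) * γ + ρ, γ, ?_, .step S γ ρ _ h hq⟩
    rw [natDegree_mul_add_of_lt hq h.natDegree_lt, natDegree_X_pow]
    omega

theorem blockStart_insert_of_le {S : Finset ℕ} {s i : ℕ} (hS : ∀ t ∈ S, t ≤ s) (hsi : s ≤ i) :
    blockStart (insert s S) i = s := by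
  refine blockStart_eq (Or.inr (Finset.mem_insert_self _ _)) hsi fun t ht _ => ?_
  rcases Finset.mem_insert.1 ht with rfl | ht
  · exact le_rfl
  · exact hS t ht

theorem blockEnd_insert_of_le {S : Finset ℕ} {s i m : ℕ} (hS : ∀ t ∈ S, t ≤ s) (hsi : s ≤ i)
    (him : i < m) : blockEnd (insert s S) m i = m := by
  refine blockEnd_eq (Or.inr rfl) him le_rfl fun t ht hti => ?_
  rcases Finset.mem_insert.1 ht with rfl | ht
  · omega
  · have := hS t ht
    omega

theorem blockStart_insert_of_lt {S : Finset ℕ} {s i : ℕ} (his : i < s) :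
    blockStart (insert s S) i = blockStart S i := by
  refine blockStart_eq ?_ blockStart_le fun t ht hti => ?_
  · exact blockStart_mem.imp_right (Finset.mem_insert_of_mem)
  · rcases Finset.mem_insert.1 ht with rfl | ht
    · omega
    · exact le_blockStart ht hti

theorem blockEnd_insert_of_lt {S : Finset ℕ} {s i m : ℕ} (his : i < s) (hsm : s ≤ m) :
    blockEnd (insert s S) m i = blockEnd S s i := by
  have h := blockEnd_spec (S := S) his
  refine blockEnd_eq ?_ h.1 ((blockEnd_le_self his).trans hsm) fun t ht hti => ?_
  · rcases h.2 with h | h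
    · exact Or.inl (Finset.mem_insert_of_mem h)
    · exact Or.inl (by rw [h]; exact Finset.mem_insert_self _ _)
  · rcases Finset.mem_insert.1 ht with rfl | ht
    · exact blockEnd_le_self his
    · exact blockEnd_le ht hti

/-- A drop in degree means that the leading terms cancel. -/
theorem natDegree_eq_of_natDegree_add_lt {p q : K[X]} {i : ℕ} (h : (p + q).natDegree = i)
    (hp : i < p.natDegree) : q.natDegree = p.natDegree := by
  rcases lt_trichotomy p.natDegree q.natDegree with h' | h' | h'
  · rw [natDegree_add_eq_right_of_natDegree_lt h'] at h
    omega
  · exact h'.symm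
  · rw [natDegree_add_eq_left_of_natDegree_lt h'] at h
    omega

/-- In each degree `i < deg φ` there is a monic combination of `φ` and `γ` whose cofactor at `γ`
has the smallest possible degree; see `EuclidDegrees.le_natDegree_cofactor`. -/
theorem EuclidDegrees.exists_combination {S : Finset ℕ} {φ γ : K[X]} (h : EuclidDegrees S φ γ) :
    ∀ i < φ.natDegree, ∃ u v : K[X], (u * φ + v * γ).Monic ∧ (u * φ + v * γ).natDegree = i ∧
      v.natDegree + (blockStart S i + blockEnd S φ.natDegree i) = φ.natDegree + i := by
  -- In the top block, deg γ ≤ i, a monomial multiple of γ normalized to be monic is enough.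
  have top : ∀ (φ γ : K[X]) (i : ℕ), γ ≠ 0 → γ.natDegree ≤ i → ∃ u v : K[X],
      (u * φ + v * γ).Monic ∧ (u * φ + v * γ).natDegree = i ∧ v.natDegree + γ.natDegree = i := by
    intro φ γ i hγ hi
    have hm : (X ^ (i - γ.natDegree) * (γ * C γ.leadingCoeff⁻¹)).Monic :=
      (monic_X_pow _).mul (monic_mul_leadingCoeff_inv hγ)
    have hX : (X ^ (i - γ.natDegree) : K[X]) ≠ 0 := (monic_X_pow _).ne_zero
    have hC : γ.leadingCoeff⁻¹ ≠ 0 := inv_ne_zero (leadingCoeff_ne_zero.2 hγ)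
    have heq : 0 * φ + X ^ (i - γ.natDegree) * C γ.leadingCoeff⁻¹ * γ =
      X ^ (i - γ.natDegree) * (γ * C γ.leadingCoeff⁻¹) := by ring
    refine ⟨0, X ^ (i - γ.natDegree) * C γ.leadingCoeff⁻¹, heq ▸ hm, ?_, ?_⟩
    · rw [heq, natDegree_mul hX (mul_ne_zero hγ (C_ne_zero.2 hC)), natDegree_mul_C hC,
        natDegree_X_pow]
      omega
    · rw [natDegree_mul_C hC, natDegree_X_pow]
      omega
  induction h with
  | unit φ γ hφ hγ =>
    intro i hi
    have h0 := natDegree_eq_zero_of_isUnit hγ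
    obtain ⟨u, v, h1, h2, h3⟩ := top φ γ i hγ.ne_zero (by omega)
    refine ⟨u, v, h1, h2, ?_⟩
    rw [blockStart_eq (a := 0) (Or.inl rfl) (Nat.zero_le _) (by simp),
      blockEnd_eq (Or.inr rfl) hi le_rfl (by simp)]
    omega
  | step S γ ρ q h hq ih =>
    intro i hi
    have hdeg := natDegree_mul_add_of_lt hq h.natDegree_lt
    have hS : ∀ t ∈ S, t ≤ γ.natDegree := fun t ht => (h.le_natDegree t ht).trans h.natDegree_lt.le
    have hγ0 : γ ≠ 0 := by rintro rfl; simpa using h.natDegree_lt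
    rcases le_or_gt γ.natDegree i with hsi | his
    · obtain ⟨u, v, h1, h2, h3⟩ := top (q * γ + ρ) γ i hγ0 hsi
      refine ⟨u, v, h1, h2, ?_⟩
      rw [blockStart_insert_of_le hS hsi, blockEnd_insert_of_le hS hsi hi]
      omega
    · obtain ⟨u, v, h1, h2, h3⟩ := ih i his
      -- Below deg γ, a combination of γ and ρ is read as one of φ = qγ + ρ and γ; the old cofactor
      -- v of ρ becomes the cofactor of φ.
      have heq : v * (q * γ + ρ) + (u - v * q) * γ = u * γ + v * ρ := by ring
      refine ⟨v, u - v * q, heq ▸ h1, heq ▸ h2, ?_⟩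
      rw [blockStart_insert_of_lt his, blockEnd_insert_of_lt his (by omega)]
      have hv : v ≠ 0 := by
        rintro rfl
        rw [zero_mul, add_zero] at h2
        have hu : u ≠ 0 := by
          rintro rfl
          simp [Monic] at h1
        rw [natDegree_mul hu hγ0] at h2
        omega
      have hq0 : q ≠ 0 := by rintro rfl; simp at hq
      have hφ0 : q * γ + ρ ≠ 0 := by intro h0; rw [h0] at hi; simp at hi
      rw [← heq] at h2
      -- The sum has degree below deg γ, so its two terms have equal degree; the new cofactor has
      -- degree deg v + deg φ - deg γ.
      have h4 := natDegree_eq_of_natDegree_add_lt h2 (by rw [natDegree_mul hv hφ0]; omega)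
      have h5 : u - v * q ≠ 0 := by
        intro h0
        rw [h0, zero_mul, natDegree_zero, natDegree_mul hv hφ0] at h4
        omega
      rw [natDegree_mul h5 hγ0, natDegree_mul hv hφ0] at h4
      omega

/-- Same induction as for existence. In the top block, either u = 0 or the leading term of uφ must
be cancelled by vγ, so vγ has degree at least that of the combination. Below deg γ, cancellation
gives deg v = deg u + deg φ - deg γ, and u is the cofactor of ρ in a combination of γ and ρ, to
which induction applies. -/
theorem EuclidDegrees.le_natDegree_cofactor {S : Finset ℕ} {φ γ : K[X]} (h : EuclidDegrees S φ γ) :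
    ∀ u v : K[X], u * φ + v * γ ≠ 0 → (u * φ + v * γ).natDegree < φ.natDegree →
      φ.natDegree + (u * φ + v * γ).natDegree ≤ v.natDegree +
        (blockStart S (u * φ + v * γ).natDegree +
          blockEnd S φ.natDegree (u * φ + v * γ).natDegree) := by
  have top : ∀ φ γ u v : K[X], γ ≠ 0 → γ.natDegree < φ.natDegree →
      (u * φ + v * γ).natDegree < φ.natDegree →
      (u * φ + v * γ).natDegree ≤ v.natDegree + γ.natDegree := by
    intro φ γ u v hγ hlt hi
    rcases eq_or_ne u 0 with rfl | hu
    · rw [zero_mul, zero_add]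
      exact natDegree_mul_le
    · have hφ : φ ≠ 0 := by rintro rfl; simp at hlt
      have h1 := natDegree_mul hu hφ
      have h2 := natDegree_eq_of_natDegree_add_lt rfl (hi.trans_le (by omega :
        φ.natDegree ≤ (u * φ).natDegree))
      have h3 := natDegree_mul_le (p := v) (q := γ)
      omega
  induction h with
  | unit φ γ hφ hγ =>
    intro u v _ hi
    have h0 := natDegree_eq_zero_of_isUnit hγ
    have h1 := top φ γ u v hγ.ne_zero (by omega) hi
    rw [blockStart_eq (a := 0) (Or.inl rfl) (Nat.zero_le _) (by simp),
      blockEnd_eq (Or.inr rfl) hi le_rfl (by simp)]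
    omega
  | step S γ ρ q h hq ih =>
    intro u v hne hi
    have hdeg := natDegree_mul_add_of_lt hq h.natDegree_lt
    have hS : ∀ t ∈ S, t ≤ γ.natDegree := fun t ht => (h.le_natDegree t ht).trans h.natDegree_lt.le
    have hγ0 : γ ≠ 0 := by rintro rfl; simpa using h.natDegree_lt
    have hφ0 : q * γ + ρ ≠ 0 := by intro h0; rw [h0] at hi; simp at hi
    rcases le_or_gt γ.natDegree (u * (q * γ + ρ) + v * γ).natDegree with hsi | his
    · have h1 := top (q * γ + ρ) γ u v hγ0 (by omega) hi
      rw [blockStart_insert_of_le hS hsi, blockEnd_insert_of_le hS hsi hi]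
      omega
    · have hu : u ≠ 0 := by
        rintro rfl
        rw [zero_mul, zero_add] at his hne
        rw [natDegree_mul (left_ne_zero_of_mul hne) hγ0] at his
        omega
      have h4 := natDegree_eq_of_natDegree_add_lt rfl (his.trans_le (by
        rw [natDegree_mul hu hφ0]; omega :
        γ.natDegree ≤ (u * (q * γ + ρ)).natDegree))
      rw [natDegree_mul hu hφ0] at h4
      have h5 := natDegree_mul_le (p := v) (q := γ)
      have heq : u * (q * γ + ρ) + v * γ = (v + u * q) * γ + u * ρ := by ring
      have h6 := ih (v + u * q) u (heq ▸ hne) (heq ▸ his)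
      rw [← heq] at h6
      rw [blockStart_insert_of_lt his, blockEnd_insert_of_lt his (by omega)]
      omega

end Euclid

/-! ### Uniqueness of the Jordan type. -/

section JordanType

variable {K V : Type*} [Field K] [AddCommGroup V] [Module K V]

theorem jordan_basis_pow_apply {φ : V →ₗ[K] V} {P : YoungDiagram} {b : Module.Basis P.cells K V}
    (hb : ∀ c : P.cells,
      φ (b c) = if h : (c.1.1, c.1.2 + 1) ∈ P.cells then b ⟨(c.1.1, c.1.2 + 1), h⟩ else 0)
    (n : ℕ) (c : P.cells) :
    (φ ^ n) (b c) = if h : (c.1.1, c.1.2 + n) ∈ P.cells then b ⟨(c.1.1, c.1.2 + n), h⟩ else 0 := by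
  induction n with
  | zero => simp
  | succ n ih =>
    rw [pow_succ', Module.End.mul_apply, ih]
    by_cases h : (c.1.1, c.1.2 + n) ∈ P.cells
    · rw [dif_pos h, hb]
      rfl
    · rw [dif_neg h, map_zero, dif_neg]
      intro h'
      exact h (P.isLowerSet (show (c.1.1, c.1.2 + n) ≤ (c.1.1, c.1.2 + (n + 1)) from
        ⟨le_rfl, by dsimp only; omega⟩) h')

/-- φ^n moves each basis vector n cells to the right or kills it, so its range is spanned by the
basis vectors in columns n and beyond. -/
theorem HasJordanType.finrank_range_pow {φ : V →ₗ[K] V} {P : YoungDiagram}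
    (h : HasJordanType φ P) (n : ℕ) :
    Module.finrank K (LinearMap.range (φ ^ n)) = (P.cells.filter (n ≤ ·.2)).card := by
  obtain ⟨b, hb⟩ := h
  have hpow := jordan_basis_pow_apply hb n
  let e : {c // c ∈ P.cells.filter (n ≤ ·.2)} → P.cells :=
    fun c => ⟨c.1, (Finset.mem_filter.1 c.2).1⟩
  have he : Function.Injective e := fun c c' hc =>
    Subtype.ext (congrArg (fun x : P.cells => x.1) hc)
  have hf : LinearIndependent K (b ∘ e) := b.linearIndependent.comp e he
  have hrange : LinearMap.range (φ ^ n) = Submodule.span K (Set.range (b ∘ e)) := by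
    apply le_antisymm
    · rw [LinearMap.range_eq_map, ← b.span_eq, Submodule.map_span, Submodule.span_le]
      rintro _ ⟨_, ⟨c, rfl⟩, rfl⟩
      rw [SetLike.mem_coe, hpow]
      split_ifs with hc
      · exact Submodule.subset_span ⟨⟨_, Finset.mem_filter.2 ⟨hc, by dsimp only; omega⟩⟩, rfl⟩
      · exact zero_mem _
    · rw [Submodule.span_le]
      rintro _ ⟨⟨⟨i, c⟩, hc⟩, rfl⟩
      have hc' := Finset.mem_filter.1 hc
      dsimp only at hc'
      have hmem : (i, c - n) ∈ P.cells := P.isLowerSet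
        (show (i, c - n) ≤ (i, c) from ⟨le_rfl, by dsimp only; omega⟩) hc'.1
      refine ⟨b ⟨(i, c - n), hmem⟩, ?_⟩
      have heq : c - n + n = c := by omega
      rw [hpow]
      simp only [heq, dif_pos hc'.1]
      rfl
  rw [hrange, finrank_span_eq_card hf, Fintype.card_coe]

theorem YoungDiagram.ext_colLen {P Q : YoungDiagram} (h : ∀ j, P.colLen j = Q.colLen j) :
    P = Q := by
  ext ⟨i, j⟩
  rw [YoungDiagram.mem_cells, YoungDiagram.mem_cells, YoungDiagram.mem_iff_lt_colLen,
    YoungDiagram.mem_iff_lt_colLen, h]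

theorem YoungDiagram.card_filter_le_snd (P : YoungDiagram) (n : ℕ) :
    (P.cells.filter (n ≤ ·.2)).card = P.colLen n + (P.cells.filter (n + 1 ≤ ·.2)).card := by
  rw [YoungDiagram.colLen_eq_card, YoungDiagram.col, ← Finset.card_union_of_disjoint]
  · congr 1
    ext c
    simp only [Finset.mem_union, Finset.mem_filter]
    constructor
    · rintro ⟨h1, h2⟩
      rcases h2.eq_or_lt with h | h
      · exact Or.inl ⟨h1, h.symm⟩
      · exact Or.inr ⟨h1, h⟩
    · rintro (⟨h1, h2⟩ | ⟨h1, h2⟩)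
      · exact ⟨h1, h2.ge⟩
      · exact ⟨h1, by omega⟩
  · rw [Finset.disjoint_filter]
    intro c _ h1 h2
    omega

/-- Successive differences of the ranks of the powers are the column lengths. -/
theorem HasJordanType.unique {φ : V →ₗ[K] V} {P Q : YoungDiagram}
    (hP : HasJordanType φ P) (hQ : HasJordanType φ Q) : P = Q := by
  refine YoungDiagram.ext_colLen fun n => ?_
  have h1 := P.card_filter_le_snd n
  have h2 := Q.card_filter_le_snd n
  rw [← hP.finrank_range_pow, ← hP.finrank_range_pow] at h1
  rw [← hQ.finrank_range_pow, ← hQ.finrank_range_pow] at h2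
  omega

theorem HasJordanType.congr {W : Type*} [AddCommGroup W] [Module K W] {φ : V →ₗ[K] V}
    {ψ : W →ₗ[K] W} {P : YoungDiagram} (h : HasJordanType φ P) (e : V ≃ₗ[K] W)
    (he : ∀ x, e (φ x) = ψ (e x)) : HasJordanType ψ P := by
  obtain ⟨b, hb⟩ := h
  refine ⟨b.map e, fun c => ?_⟩
  rw [Module.Basis.map_apply, ← he, hb]
  split_ifs <;> simp

end JordanType

/-! ### Forms in two variables as polynomials in one, and the Jordan basis. -/

section Dehomogenization

open Polynomial

variable {K : Type*} [Field K]

/-- Setting the second variable to `1`. -/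
noncomputable def dehomogenize : MvPolynomial (Fin 2) K →ₐ[K] K[X] :=
  MvPolynomial.aeval ![X, 1]

/-- The map whose `n`-th coefficient dehomogenizes the component of degree `n`. -/
noncomputable def dehomogenizeComponents : MvPolynomial (Fin 2) K →ₐ[K] K[X][X] :=
  MvPolynomial.aeval ![C X * X, X]

variable {f g h : MvPolynomial (Fin 2) K} {m e n : ℕ}

theorem homogenize_dehomogenize (hf : f.IsHomogeneous n) : (dehomogenize f).homogenize n = f :=
  homogenize_eq_of_isHomogeneous hf rfl

theorem dehomogenize_homogenize {p : K[X]} (hp : p.natDegree ≤ n) :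
    dehomogenize (p.homogenize n) = p :=
  aeval_homogenize_X_one p hp

theorem natDegree_dehomogenize_le (hf : f.IsHomogeneous n) : (dehomogenize f).natDegree ≤ n := by
  rw [f.as_sum, map_sum]
  refine natDegree_sum_le_of_forall_le _ _ fun s hs => ?_
  have h1 : s.weight 1 = n := hf (by simpa using hs)
  have h2 : s 0 + s 1 = n := by
    simpa [Finsupp.weight_apply, Finsupp.sum_fintype, Fin.sum_univ_two] using h1
  rw [dehomogenize, MvPolynomial.aeval_monomial, Finsupp.prod_fintype _ _ (by simp),
    Fin.prod_univ_two]
  simp only [Matrix.cons_val_zero, Matrix.cons_val_one, one_pow, mul_one]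
  refine natDegree_mul_le.trans ?_
  rw [← C_eq_algebraMap, natDegree_C, natDegree_X_pow]
  omega

theorem dehomogenizeComponents_homogenize {p : K[X]} (hp : p.natDegree ≤ n) :
    dehomogenizeComponents (p.homogenize n) = C p * X ^ n := by
  refine Polynomial.induction_with_natDegree_le
    (fun p => dehomogenizeComponents (p.homogenize n) = C p * X ^ n) n ?_ ?_ ?_ p hp
  · simp
  · intro k a _ hk
    rw [homogenize_C_mul, homogenize_X_pow hk, dehomogenizeComponents, map_mul, map_mul, map_pow,
      map_pow, MvPolynomial.aeval_X, MvPolynomial.aeval_X, MvPolynomial.algHom_C]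
    simp only [Matrix.cons_val_zero, Matrix.cons_val_one, map_mul, map_pow]
    rw [mul_pow, mul_assoc, ← pow_add, Nat.add_sub_cancel' hk, ← mul_assoc]
    rfl
  · intro p q _ _ hp hq
    rw [homogenize_add, map_add, hp, hq, C_add, add_mul]

theorem dehomogenizeComponents_of_isHomogeneous (hf : f.IsHomogeneous n) :
    dehomogenizeComponents f = C (dehomogenize f) * X ^ n := by
  conv_lhs => rw [← homogenize_dehomogenize hf]
  exact dehomogenizeComponents_homogenize (natDegree_dehomogenize_le hf)

theorem natDegree_coeff_dehomogenizeComponents_le (f : MvPolynomial (Fin 2) K) (n : ℕ) :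
    ((dehomogenizeComponents f).coeff n).natDegree ≤ n := by
  rw [← MvPolynomial.sum_homogeneousComponent f, map_sum, finsetSum_coeff]
  refine natDegree_sum_le_of_forall_le _ _ fun i _ => ?_
  rw [dehomogenizeComponents_of_isHomogeneous
    (MvPolynomial.homogeneousComponent_isHomogeneous i f), coeff_C_mul_X_pow]
  split_ifs with h
  · rw [h]
    exact natDegree_dehomogenize_le (MvPolynomial.homogeneousComponent_isHomogeneous i f)
  · simp

theorem exists_combination_of_mem_span (hf : f.IsHomogeneous m) (hg : g.IsHomogeneous e)
    (hh : h ∈ Ideal.span {f, g}) (n : ℕ) : ∃ u v : K[X],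
      (dehomogenizeComponents h).coeff n = u * dehomogenize f + v * dehomogenize g ∧
        (v = 0 ∨ v.natDegree + e ≤ n) := by
  obtain ⟨a, b, rfl⟩ := Ideal.mem_span_pair.1 hh
  refine ⟨if m ≤ n then (dehomogenizeComponents a).coeff (n - m) else 0,
    if e ≤ n then (dehomogenizeComponents b).coeff (n - e) else 0, ?_, ?_⟩
  · rw [map_add, map_mul, map_mul, dehomogenizeComponents_of_isHomogeneous hf,
      dehomogenizeComponents_of_isHomogeneous hg, ← mul_assoc, ← mul_assoc, coeff_add,
      coeff_mul_X_pow', coeff_mul_X_pow', coeff_mul_C, coeff_mul_C]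
    split_ifs <;> simp
  · split_ifs with h
    · right
      have := natDegree_coeff_dehomogenizeComponents_le b (n - e)
      omega
    · exact Or.inl rfl

/-- Only the cofactor of g needs a degree bound: since the dehomogenization of f has full degree m,
the bound for u follows by subtraction. -/
theorem homogenize_combination_mem (hf : f.IsHomogeneous m) (hg : g.IsHomogeneous e)
    (hm : (dehomogenize f).natDegree = m) (hf0 : dehomogenize f ≠ 0) {u v : K[X]}
    (hn : (u * dehomogenize f + v * dehomogenize g).natDegree ≤ n)
    (hv : v = 0 ∨ v.natDegree + e ≤ n) :
    (u * dehomogenize f + v * dehomogenize g).homogenize n ∈ Ideal.span {f, g} := by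
  have hg' := natDegree_dehomogenize_le hg
  have h1 : (v * dehomogenize g).natDegree ≤ n := by
    rcases hv with rfl | hv
    · simp
    · exact natDegree_mul_le.trans (by omega)
  have h2 : (u * dehomogenize f).natDegree ≤ n := by
    have := natDegree_sub_le (u * dehomogenize f + v * dehomogenize g) (v * dehomogenize g)
    rw [add_sub_cancel_right] at this
    omega
  rw [homogenize_add]
  refine add_mem ?_ ?_
  · rcases eq_or_ne u 0 with rfl | hu
    · simp
    · rw [natDegree_mul hu hf0] at h2
      have h3 := homogenize_mul u (dehomogenize f) (m := n - m) (n := m) (by omega) hm.le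
      rw [Nat.sub_add_cancel (by omega), homogenize_dehomogenize hf] at h3
      rw [h3]
      exact Ideal.mul_mem_left _ _ (Ideal.subset_span (by simp))
  · rcases hv with rfl | hv
    · simp
    · have h3 := homogenize_mul v (dehomogenize g) (m := n - e) (n := e) (by omega) hg'
      rw [Nat.sub_add_cancel (by omega), homogenize_dehomogenize hg] at h3
      rw [h3]
      exact Ideal.mul_mem_left _ _ (Ideal.subset_span (by simp))

theorem X_pow_mul_homogenize {p : K[X]} (hp : p.natDegree ≤ n) (c : ℕ) :
    MvPolynomial.X 1 ^ c * p.homogenize n = p.homogenize (n + c) := by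
  have h := homogenize_mul p 1 hp (natDegree_one.trans_le (Nat.zero_le c))
  rw [mul_one, homogenize_one] at h
  rw [h, mul_comm]

theorem homogenize_eq_sum {p : K[X]} (hp : p.natDegree ≤ n) : p.homogenize n =
    ∑ j ∈ Finset.range (n + 1), p.coeff j • (MvPolynomial.X 0 ^ j * MvPolynomial.X 1 ^ (n - j)) := by
  conv_lhs => rw [p.as_sum_range' (n + 1) (by omega), homogenize_finsetSum]
  refine Finset.sum_congr rfl fun j hj => ?_
  rw [Finset.mem_range] at hj
  rw [← C_mul_X_pow_eq_monomial, homogenize_C_mul, homogenize_X_pow (by omega),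
    MvPolynomial.smul_eq_C_mul]

/-- If `w i` is monic of degree `i` for all `i`, then the products of the homogenizations of the
`w i` and the powers of the second variable span all bivariate polynomials. -/
theorem mem_of_forall_homogenize_mem {M : Submodule K (MvPolynomial (Fin 2) K)} {w : ℕ → K[X]}
    (hw : ∀ i, (w i).Monic) (hdeg : ∀ i, (w i).natDegree = i)
    (hM : ∀ i c, (w i).homogenize (i + c) ∈ M) (h : MvPolynomial (Fin 2) K) : h ∈ M := by
  have key : ∀ i c, (MvPolynomial.X 0 ^ i * MvPolynomial.X 1 ^ c : MvPolynomial (Fin 2) K) ∈ M := by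
    intro i
    induction i using Nat.strong_induction_on with
    | _ i ih =>
      intro c
      have h1 := homogenize_eq_sum (p := w i) (n := i) (hdeg i).le
      have h2 := hM i c
      rw [← X_pow_mul_homogenize (hdeg i).le, h1, Finset.mul_sum, Finset.sum_range_succ] at h2
      have h3 : (w i).coeff i = 1 := by
        have := hw i
        rwa [Monic, leadingCoeff, hdeg] at this
      rw [h3, one_smul, Nat.sub_self, pow_zero, mul_one, mul_comm] at h2
      rw [mul_comm (MvPolynomial.X 0 ^ i)] at h2 ⊢
      refine (Submodule.add_mem_iff_right _ (Submodule.sum_mem _ fun j hj => ?_)).1 h2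
      rw [Finset.mem_range] at hj
      have h4 := M.smul_mem ((w i).coeff j) (ih j hj (i - j + c))
      rw [pow_add] at h4
      convert h4 using 1
      rw [mul_smul_comm]
      congr 1
      ring
  induction h using MvPolynomial.induction_on' with
  | add p q hp hq => exact add_mem hp hq
  | monomial s a =>
    have h1 := M.smul_mem a (key (s 0) (s 1))
    convert h1 using 1
    rw [MvPolynomial.monomial_eq, Finsupp.prod_fintype _ _ (by simp), Fin.prod_univ_two,
      MvPolynomial.smul_eq_C_mul]

/-- The Jordan basis consists of the classes of y^c times the homogenized w_i, for c < p i. By `hW`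
the string of w_i enters the ideal at c = p i; by `hL` no nontrivial combination enters earlier. -/
theorem hasJordanType_of_combinations (hf : f.IsHomogeneous m) (hg : g.IsHomogeneous e)
    (hm : (dehomogenize f).natDegree = m) (hf0 : dehomogenize f ≠ 0) {p : ℕ → ℕ}
    {P : YoungDiagram} (hP : ∀ i c, (i, c) ∈ P.cells ↔ i < m ∧ c < p i)
    (hW : ∀ i < m, ∃ u v : K[X], (u * dehomogenize f + v * dehomogenize g).Monic ∧
      (u * dehomogenize f + v * dehomogenize g).natDegree = i ∧ v.natDegree + e = i + p i)
    (hL : ∀ u v : K[X], u * dehomogenize f + v * dehomogenize g ≠ 0 →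
      (u * dehomogenize f + v * dehomogenize g).natDegree < m →
      (u * dehomogenize f + v * dehomogenize g).natDegree +
        p (u * dehomogenize f + v * dehomogenize g).natDegree ≤ v.natDegree + e) :
    HasJordanType (LinearMap.mulLeft K (Ideal.Quotient.mk (Ideal.span {f, g})
      (MvPolynomial.X 1))) P := by
  have hw : ∀ i, ∃ w : K[X], w.Monic ∧ w.natDegree = i ∧
      ∀ c, (i, c) ∉ P.cells → w.homogenize (i + c) ∈ Ideal.span {f, g} := by
    intro i
    rcases lt_or_ge i m with hi | hi
    · obtain ⟨u, v, h1, h2, h3⟩ := hW i hi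
      refine ⟨_, h1, h2, fun c hc => homogenize_combination_mem hf hg hm hf0 (by omega) ?_⟩
      rw [hP] at hc
      right
      omega
    -- For i ≥ m there is no row, and w_i is a monic multiple of the dehomogenized f, whose
    -- homogenizations all lie in the ideal.
    · have heq : X ^ (i - m) * (dehomogenize f * C (dehomogenize f).leadingCoeff⁻¹) =
          X ^ (i - m) * C (dehomogenize f).leadingCoeff⁻¹ * dehomogenize f +
            0 * dehomogenize g := by ring
      have hC : (dehomogenize f).leadingCoeff⁻¹ ≠ 0 := inv_ne_zero (leadingCoeff_ne_zero.2 hf0)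
      have hdeg : (X ^ (i - m) * (dehomogenize f * C (dehomogenize f).leadingCoeff⁻¹)).natDegree
          = i := by
        rw [natDegree_mul (pow_ne_zero _ X_ne_zero) (mul_ne_zero hf0 (C_ne_zero.2 hC)),
          natDegree_mul_C hC, natDegree_X_pow]
        omega
      refine ⟨_, (monic_X_pow _).mul (monic_mul_leadingCoeff_inv hf0), hdeg, fun c _ => ?_⟩
      rw [heq] at hdeg ⊢
      exact homogenize_combination_mem hf hg hm hf0 (by omega) (Or.inl rfl)
  choose w hmon hdeg hmem using hw
  let H : P.cells → MvPolynomial (Fin 2) K ⧸ Ideal.span {f, g} := fun c =>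
    Ideal.Quotient.mk _ ((w c.1.1).homogenize (c.1.1 + c.1.2))
  have hli : LinearIndependent K H := by
    classical
    rw [Fintype.linearIndependent_iff]
    intro a ha
    by_contra! hcon
    obtain ⟨c₀, hc₀⟩ := hcon
    set n := c₀.1.1 + c₀.1.2 with hn
    have hmemI : (∑ c, a c • (w c.1.1).homogenize (c.1.1 + c.1.2)) ∈ Ideal.span {f, g} := by
      rw [← Ideal.Quotient.eq_zero_iff_mem, map_sum]
      exact ha
    obtain ⟨u, v, huv, hv⟩ := exists_combination_of_mem_span hf hg hmemI n
    have hcoeff : (dehomogenizeComponents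
        (∑ c, a c • (w c.1.1).homogenize (c.1.1 + c.1.2))).coeff n =
        ∑ c ∈ Finset.univ.filter (fun c : P.cells => c.1.1 + c.1.2 = n), a c • w c.1.1 := by
      rw [map_sum, finsetSum_coeff, Finset.sum_filter]
      refine Finset.sum_congr rfl fun c _ => ?_
      rw [map_smul, dehomogenizeComponents_homogenize (by rw [hdeg]; omega), coeff_smul,
        coeff_C_mul_X_pow]
      split_ifs with h1 h2 h2
      · rfl
      · exact absurd h1.symm h2
      · exact absurd h2.symm h1
      · simp
    -- In degree n the surviving w_i have distinct degrees, so the largest row index with nonzero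
    -- coefficient is the degree of the whole combination.
    obtain ⟨c₁, hc₁, hmax⟩ := Finset.exists_max_image
      (Finset.univ.filter (fun c : P.cells => c.1.1 + c.1.2 = n ∧ a c ≠ 0)) (fun c => c.1.1)
      ⟨c₀, by simp [hn, hc₀]⟩
    simp only [Finset.mem_filter, Finset.mem_univ, true_and] at hc₁ hmax
    have hlow : ∀ c ∈ (Finset.univ.filter (fun c : P.cells => c.1.1 + c.1.2 = n)).erase c₁,
        (a c • w c.1.1).degree < c₁.1.1 := by
      intro c hc
      simp only [Finset.mem_erase, Finset.mem_filter, Finset.mem_univ, true_and] at hc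
      rcases eq_or_ne (a c) 0 with h0 | h0
      · rw [h0, zero_smul, degree_zero]
        exact WithBot.bot_lt_coe _
      · have h1 := hmax c ⟨hc.2, h0⟩
        have h2 : c.1.1 ≠ c₁.1.1 := fun h => hc.1 (Subtype.ext (Prod.ext h (by omega)))
        refine (degree_smul_le _ _).trans_lt ?_
        rw [degree_eq_natDegree (hmon _).ne_zero, hdeg]
        exact_mod_cast lt_of_le_of_ne h1 h2
    have hdegree : (u * dehomogenize f + v * dehomogenize g).degree = c₁.1.1 := by
      rw [← huv, hcoeff, ← Finset.add_sum_erase _ _ (show c₁ ∈ _ by simp [hc₁.1])]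
      have h1 : (a c₁ • w c₁.1.1).degree = c₁.1.1 := by
        rw [smul_eq_C_mul, degree_C_mul hc₁.2, degree_eq_natDegree (hmon _).ne_zero, hdeg]
      rw [degree_add_eq_left_of_degree_lt, h1]
      rw [h1]
      exact (degree_sum_le _ _).trans_lt ((Finset.sup_lt_iff (WithBot.bot_lt_coe _)).2 hlow)
    have hnat := natDegree_eq_of_degree_eq_some hdegree
    have hne : u * dehomogenize f + v * dehomogenize g ≠ 0 := by
      intro h0
      rw [h0, degree_zero] at hdegree
      exact WithBot.bot_ne_coe hdegree
    obtain ⟨hc1, hc2⟩ := (hP c₁.1.1 c₁.1.2).1 c₁.2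
    have hle := hL u v hne (by omega)
    rw [hnat] at hle
    -- If v = 0, a nonzero multiple of the dehomogenized f would have degree below m; otherwise `hL`
    -- forces p i ≤ c, contradicting that the cell lies in the diagram.
    rcases hv with rfl | hv
    · rw [zero_mul, add_zero] at hne hnat
      rw [natDegree_mul (left_ne_zero_of_mul hne) hf0] at hnat
      omega
    · omega
  have hspan : ⊤ ≤ Submodule.span K (Set.range H) := by
    rintro y -
    obtain ⟨h, rfl⟩ := Ideal.Quotient.mk_surjective y
    refine mem_of_forall_homogenize_mem (w := w) (M := (Submodule.span K (Set.range H)).comap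
      (Ideal.Quotient.mkₐ K (Ideal.span {f, g})).toLinearMap) hmon hdeg (fun i c => ?_) h
    by_cases hc : (i, c) ∈ P.cells
    · exact Submodule.subset_span ⟨⟨(i, c), hc⟩, rfl⟩
    · rw [Submodule.mem_comap]
      have := Ideal.Quotient.eq_zero_iff_mem.2 (hmem i c hc)
      simp only [AlgHom.toLinearMap_apply, Ideal.Quotient.mkₐ_eq_mk, this, zero_mem]
  refine ⟨Module.Basis.mk hli hspan, fun c => ?_⟩
  have hmul : LinearMap.mulLeft K (Ideal.Quotient.mk (Ideal.span {f, g}) (MvPolynomial.X 1)) (H c) =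
      Ideal.Quotient.mk _ ((w c.1.1).homogenize (c.1.1 + (c.1.2 + 1))) := by
    rw [LinearMap.mulLeft_apply, ← map_mul]
    congr 1
    simpa [add_assoc] using X_pow_mul_homogenize (p := w c.1.1) (n := c.1.1 + c.1.2)
      (by rw [hdeg]; omega) 1
  rw [Module.Basis.mk_apply, hmul]
  split_ifs with hc
  · rw [Module.Basis.mk_apply]
  · exact Ideal.Quotient.eq_zero_iff_mem.2 (hmem _ _ hc)

end Dehomogenization

/-! ### Regular pairs in a unique factorization domain. -/

section RegularSequences

open RingTheory.Sequence

variable {R : Type*} [CommRing R] [IsDomain R] {f g : R}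

theorem isWeaklyRegular_pair_iff :
    IsWeaklyRegular R [f, g] ↔ f ≠ 0 ∧ ∀ h, f ∣ g * h → f ∣ h := by
  rw [isWeaklyRegular_cons_iff, isWeaklyRegular_singleton_iff]
  refine and_congr ?_ ?_
  · rw [isSMulRegular_iff_right_eq_zero_of_smul]
    constructor
    · rintro h rfl
      exact one_ne_zero (h 1 (by simp))
    · intro h x hx
      exact (mul_eq_zero.1 hx).resolve_left h
  · rw [isSMulRegular_quotient_iff_mem_of_smul_mem]
    refine forall_congr' fun h => ?_
    simp only [Submodule.mem_smul_pointwise_iff_exists, Submodule.mem_top, true_and, smul_eq_mul]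
    simp only [dvd_def, eq_comm]

theorem isRegular_pair_iff [UniqueFactorizationMonoid R] :
    IsRegular R [f, g] ↔ f ≠ 0 ∧ IsRelPrime f g ∧ Ideal.span {f, g} ≠ ⊤ := by
  have htop : Ideal.ofList [f, g] • (⊤ : Submodule R R) = Ideal.span {f, g} := by
    simp [Ideal.ofList, Set.insert_def, or_comm]
  rw [isRegular_iff, isWeaklyRegular_pair_iff, htop, and_assoc, ne_comm (a := ⊤)]
  refine and_congr_right fun hf => and_congr_left fun _ => ⟨fun h c hcf hcg => ?_, fun h x hx => ?_⟩
  -- With f = ca and g = cb, f divides ga, hence divides a, so c is a unit.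
  · obtain ⟨a, rfl⟩ := hcf
    obtain ⟨b, rfl⟩ := hcg
    have h1 : c * a ∣ a := h a ⟨b, by ring⟩
    have ha : a ≠ 0 := right_ne_zero_of_mul hf
    obtain ⟨d, hd⟩ := h1
    refine IsUnit.of_mul_eq_one d (mul_left_cancel₀ ha ?_)
    linear_combination -hd
  · exact h.dvd_of_dvd_mul_left hx

end RegularSequences

/-! ### Coprime forms and coprime polynomials. -/

section CompleteIntersections

open Polynomial

variable {K : Type*} [Field K] {f g : MvPolynomial (Fin 2) K} {m e : ℕ}

theorem constantCoeff_eq_zero_of_isHomogeneous (hf : f.IsHomogeneous m) (hm : 0 < m) :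
    MvPolynomial.constantCoeff f = 0 := by
  by_contra h
  have : Finsupp.weight (1 : Fin 2 → ℕ) 0 = m := hf h
  rw [map_zero] at this
  omega

theorem span_pair_ne_top (hf : f.IsHomogeneous m) (hg : g.IsHomogeneous e) (hm : 0 < m)
    (he : 0 < e) : Ideal.span {f, g} ≠ ⊤ := by
  intro h
  have h1 : Ideal.span {f, g} ≤ RingHom.ker (MvPolynomial.constantCoeff (σ := Fin 2) (R := K)) := by
    rw [Ideal.span_le]
    rintro x (rfl | rfl)
    · exact constantCoeff_eq_zero_of_isHomogeneous hf hm
    · exact constantCoeff_eq_zero_of_isHomogeneous hg he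
  rw [h] at h1
  have h2 := h1 (Submodule.mem_top (x := (1 : MvPolynomial (Fin 2) K)))
  simp at h2

theorem pos_of_isHomogeneous_of_not_isUnit (hf : f.IsHomogeneous m) (hf0 : f ≠ 0)
    (hu : ¬ IsUnit f) : 0 < m := by
  rcases Nat.eq_zero_or_pos m with rfl | h
  · exfalso
    have h1 : f.totalDegree = 0 := hf.totalDegree hf0
    rw [MvPolynomial.totalDegree_eq_zero_iff_eq_C] at h1
    rw [h1] at hu hf0
    exact hu ((isUnit_iff_ne_zero.2 fun h0 => hf0 (by rw [h0, map_zero])).map MvPolynomial.C)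
  · exact h

/-- The ideals generated by a regular sequence of two forms are those generated by two relatively
prime forms of positive degree. -/
theorem isGradedCompleteIntersection_iff {I : Ideal (MvPolynomial (Fin 2) K)} :
    IsGradedCompleteIntersection I ↔ ∃ (f g : MvPolynomial (Fin 2) K) (m e : ℕ),
      f.IsHomogeneous m ∧ g.IsHomogeneous e ∧ 0 < m ∧ 0 < e ∧ IsRelPrime f g ∧
        I = Ideal.span {f, g} := by
  constructor
  · rintro ⟨f, g, m, e, hf, hg, hreg, rfl⟩
    obtain ⟨hf0, hrel, htop⟩ := isRegular_pair_iff.1 hreg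
    have hfu : ¬ IsUnit f := fun h => htop (Ideal.eq_top_of_isUnit_mem _
      (Ideal.subset_span (by simp)) h)
    have hgu : ¬ IsUnit g := fun h => htop (Ideal.eq_top_of_isUnit_mem _
      (Ideal.subset_span (by simp)) h)
    have hg0 : g ≠ 0 := by
      rintro rfl
      exact hfu (hrel dvd_rfl (dvd_zero f))
    exact ⟨f, g, m, e, hf, hg, pos_of_isHomogeneous_of_not_isUnit hf hf0 hfu,
      pos_of_isHomogeneous_of_not_isUnit hg hg0 hgu, hrel, rfl⟩
  · rintro ⟨f, g, m, e, hf, hg, hm, he, hrel, rfl⟩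
    have htop := span_pair_ne_top hf hg hm he
    rcases eq_or_ne f 0 with rfl | hf0
    · have hg1 : IsUnit g := hrel (dvd_zero g) dvd_rfl
      exact absurd (Ideal.eq_top_of_isUnit_mem _ (Ideal.subset_span (by simp)) hg1) htop
    · exact ⟨f, g, m, e, hf, hg, isRegular_pair_iff.2 ⟨hf0, hrel, htop⟩, rfl⟩

theorem natDegree_dehomogenize_of_not_dvd (hf : f.IsHomogeneous m)
    (h : ¬ MvPolynomial.X 1 ∣ f) : (dehomogenize f).natDegree = m := by
  refine le_antisymm (natDegree_dehomogenize_le hf) (not_lt.1 fun hlt => h ?_)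
  have h1 := X_pow_mul_homogenize (p := dehomogenize f) (n := m - 1) (by omega) 1
  rw [Nat.sub_add_cancel (by omega), homogenize_dehomogenize hf, pow_one] at h1
  exact ⟨_, h1.symm⟩

/-- A common divisor of the dehomogenizations homogenizes to a common divisor of f and g. -/
theorem isCoprime_dehomogenize (hf : f.IsHomogeneous m) (hg : g.IsHomogeneous e)
    (h : IsRelPrime f g) : IsCoprime (dehomogenize f) (dehomogenize g) := by
  refine IsRelPrime.isCoprime fun c hcf hcg => ?_
  have key : ∀ {f : MvPolynomial (Fin 2) K} {m : ℕ}, f.IsHomogeneous m → c ∣ dehomogenize f →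
      c.homogenize c.natDegree ∣ f := by
    intro f m hf ⟨q, hq⟩
    rcases eq_or_ne f 0 with rfl | hf0
    · exact dvd_zero _
    have h0 : c * q ≠ 0 := by
      rw [← hq]
      intro h0
      rw [← homogenize_dehomogenize hf, h0, homogenize_zero] at hf0
      exact hf0 rfl
    have h1 := natDegree_mul (left_ne_zero_of_mul h0) (right_ne_zero_of_mul h0)
    have h2 := natDegree_dehomogenize_le hf
    rw [hq, h1] at h2
    have h3 := homogenize_mul c q (n := m - c.natDegree) le_rfl (by omega)
    rw [← hq, Nat.add_sub_cancel' (by omega), homogenize_dehomogenize hf] at h3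
    exact ⟨_, h3⟩
  have h1 := (h (key hf hcf) (key hg hcg)).map (dehomogenize (K := K))
  rwa [dehomogenize_homogenize le_rfl] at h1

theorem not_X_dvd_homogenize {p : K[X]} (hp : p ≠ 0) :
    ¬ MvPolynomial.X 1 ∣ p.homogenize p.natDegree := by
  rintro ⟨q, hq⟩
  -- Setting y = 0 leaves only the leading term of p.
  have h1 := congrArg (MvPolynomial.aeval ![(X : K[X]), 0]) hq
  rw [homogenize_eq_sum le_rfl, map_sum, map_mul, Finset.sum_range_succ,
    Finset.sum_eq_zero fun j hj => ?_] at h1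
  · simp [hp] at h1
  · rw [Finset.mem_range] at hj
    rw [map_smul, map_mul, map_pow, map_pow, MvPolynomial.aeval_X, MvPolynomial.aeval_X]
    simp [show p.natDegree - j ≠ 0 by omega]

/-- Homogenizing a Bézout identity puts a power of y in the ideal, so a common divisor is associated
to a power of y; but y does not divide the first form. -/
theorem isRelPrime_homogenize {p q : K[X]} (hp : p ≠ 0) (hq : q.natDegree ≤ e)
    (h : IsCoprime p q) : IsRelPrime (p.homogenize p.natDegree) (q.homogenize e) := by
  intro c hcp hcq
  obtain ⟨u, v, huv⟩ := h
  set N := max (u.natDegree + p.natDegree) (v.natDegree + e)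
  have h1 : (MvPolynomial.X 1 : MvPolynomial (Fin 2) K) ^ N =
      u.homogenize (N - p.natDegree) * p.homogenize p.natDegree +
        v.homogenize (N - e) * q.homogenize e := by
    rw [← homogenize_mul _ _ (by omega) le_rfl, ← homogenize_mul _ _ (by omega) hq,
      Nat.sub_add_cancel (by omega), Nat.sub_add_cancel (by omega), ← homogenize_add, huv,
      homogenize_one]
  have h2 : c ∣ (MvPolynomial.X 1 : MvPolynomial (Fin 2) K) ^ N := by
    rw [h1]
    exact dvd_add (hcp.mul_left _) (hcq.mul_left _)
  obtain ⟨i, hi, hass⟩ := (dvd_prime_pow (MvPolynomial.X_prime (R := K) (i := (1 : Fin 2))) N).1 h2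
  rcases Nat.eq_zero_or_pos i with rfl | hpos
  · rw [pow_zero] at hass
    exact associated_one_iff_isUnit.1 hass
  · exact absurd (((dvd_pow_self _ hpos.ne').trans hass.symm.dvd).trans hcp)
      (not_X_dvd_homogenize hp)

/-- The Jordan type is read off from the Euclidean algorithm for the dehomogenized generators. -/
theorem hasJordanType_layeredDiagram {S : Finset ℕ} (hf : f.IsHomogeneous m)
    (hg : g.IsHomogeneous e) (hm : (dehomogenize f).natDegree = m) (hSe : ∀ t ∈ S, t < e)
    (he : 0 < e) (hS : EuclidDegrees S (dehomogenize f) (dehomogenize g)) :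
    HasJordanType (LinearMap.mulLeft K (Ideal.Quotient.mk (Ideal.span {f, g})
      (MvPolynomial.X 1))) (layeredDiagram S m e) := by
  have hf0 : dehomogenize f ≠ 0 := by
    intro h0
    simpa [h0] using hS.natDegree_lt
  have hlt : ∀ i < m, blockStart S i + blockEnd S m i < m + e := fun i hi =>
    blockStart_add_blockEnd_lt he hSe hi
  refine hasJordanType_of_combinations hf hg hm hf0
    (p := fun i => m + e - (blockStart S i + blockEnd S m i))
    (fun i c => mem_layeredDiagram) (fun i hi => ?_) (fun u v hne hi => ?_)
  · obtain ⟨u, v, h1, h2, h3⟩ := hS.exists_combination i (by omega)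
    refine ⟨u, v, h1, h2, ?_⟩
    rw [hm] at h3
    have := hlt i hi
    omega
  · have h1 := hS.le_natDegree_cofactor u v hne (by omega)
    rw [hm] at h1
    have := hlt _ hi
    omega

end CompleteIntersections

/-! ### Choosing generators to which the Euclidean algorithm applies. -/

section NormalForm

open Polynomial

variable {K : Type*} [Field K] {f g : MvPolynomial (Fin 2) K} {m e : ℕ}

/-- The second generator must dehomogenize to degree less than both m and e. If e < m, then y
divides g and the degree drops by itself; if m ≤ e, g is replaced by its remainder modulo f, which
leaves the ideal unchanged. -/
theorem exists_hasJordanType_of_not_dvd (hf : f.IsHomogeneous m) (hg : g.IsHomogeneous e)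
    (hm : 0 < m) (he : 0 < e) (hrel : IsRelPrime f g) (hXf : ¬ MvPolynomial.X 1 ∣ f)
    (hXg : MvPolynomial.X 1 ∣ g ∨ m ≤ e) :
    ∃ S : Finset ℕ, (∀ t ∈ S, 0 < t ∧ t < m ∧ t < e) ∧
      HasJordanType (LinearMap.mulLeft K (Ideal.Quotient.mk (Ideal.span {f, g})
        (MvPolynomial.X 1))) (layeredDiagram S m e) := by
  have hφ := natDegree_dehomogenize_of_not_dvd hf hXf
  have hco := isCoprime_dehomogenize hf hg hrel
  have hγ := natDegree_dehomogenize_le hg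
  rcases lt_or_ge e m with hem | hme
  · have hlt : (dehomogenize g).natDegree < e := by
      refine lt_of_le_of_ne hγ fun heq => ?_
      have h0 : dehomogenize g ≠ 0 := by
        intro h0
        rw [h0, natDegree_zero] at heq
        omega
      have h1 := not_X_dvd_homogenize h0
      rw [heq, homogenize_dehomogenize hg] at h1
      exact hXg.elim h1 (by omega)
    obtain ⟨S, hS⟩ := exists_euclidDegrees _ _ (by omega) hco
    have hle := hS.le_natDegree
    refine ⟨S, fun t ht => ⟨hS.pos t ht, ?_⟩, hasJordanType_layeredDiagram hf hg hφ
      (fun t ht => (hle t ht).trans_lt hlt) he hS⟩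
    have := hle t ht
    omega
  · set φ := dehomogenize f
    set γ := dehomogenize g
    have hdiv : φ * (γ / φ) + γ % φ = γ := EuclideanDomain.div_add_mod γ φ
    have hmod : (γ % φ).natDegree < φ.natDegree := natDegree_mod_lt _ (by omega)
    have hco' : IsCoprime φ (γ % φ) := by
      rw [← hdiv, add_comm] at hco
      exact (IsCoprime.add_mul_left_right_iff (z := γ / φ)).1 hco
    have hq : (γ / φ).natDegree ≤ e - m := by
      rcases eq_or_ne (γ / φ) 0 with h0 | h0
      · simp [h0]
      · have hφ0 : φ ≠ 0 := by intro h0; rw [h0, natDegree_zero] at hφ; omega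
        have h1 := natDegree_mul hφ0 h0
        have h2 := natDegree_sub_le γ (γ % φ)
        rw [← eq_sub_iff_add_eq.2 hdiv] at h2
        omega
    have hg' : g = (γ / φ).homogenize (e - m) * f + (γ % φ).homogenize e := by
      conv_lhs => rw [← homogenize_dehomogenize hg]
      change γ.homogenize e = _
      conv_lhs => rw [← hdiv, homogenize_add, mul_comm]
      have h1 := homogenize_mul (γ / φ) φ hq hφ.le
      rw [Nat.sub_add_cancel hme] at h1
      rw [h1, homogenize_dehomogenize hf]
    have hspan : Ideal.span {f, g} = Ideal.span {f, (γ % φ).homogenize e} := by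
      apply le_antisymm <;> rw [Ideal.span_le, Set.pair_subset_iff]
      · exact ⟨Ideal.subset_span (by simp), Ideal.mem_span_pair.2
          ⟨(γ / φ).homogenize (e - m), 1, by rw [one_mul]; exact hg'.symm⟩⟩
      · exact ⟨Ideal.subset_span (by simp), Ideal.mem_span_pair.2
          ⟨-(γ / φ).homogenize (e - m), 1, by rw [one_mul, hg']; ring⟩⟩
    obtain ⟨S, hS⟩ := exists_euclidDegrees _ _ hmod hco'
    have hle := hS.le_natDegree
    refine ⟨S, fun t ht => ⟨hS.pos t ht, ?_⟩, ?_⟩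
    · have := hle t ht
      omega
    · rw [hspan]
      refine hasJordanType_layeredDiagram hf (isHomogeneous_homogenize _) hφ
        (fun t ht => ?_) he ?_
      · have := hle t ht
        omega
      · rwa [dehomogenize_homogenize (by omega)]

/-- Coprimality prevents y from dividing both generators. One not divisible by y comes first, and if
neither is divisible, one of smaller degree. -/
theorem exists_hasJordanType_of_isRelPrime (hf : f.IsHomogeneous m) (hg : g.IsHomogeneous e)
    (hm : 0 < m) (he : 0 < e) (hrel : IsRelPrime f g) :
    ∃ (S : Finset ℕ) (m e : ℕ), 0 < m ∧ 0 < e ∧ (∀ t ∈ S, 0 < t ∧ t < m ∧ t < e) ∧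
      HasJordanType (LinearMap.mulLeft K (Ideal.Quotient.mk (Ideal.span {f, g})
        (MvPolynomial.X 1))) (layeredDiagram S m e) := by
  have direct (hXf : ¬ MvPolynomial.X 1 ∣ f) (hXg : MvPolynomial.X 1 ∣ g ∨ m ≤ e) :=
    exists_hasJordanType_of_not_dvd hf hg hm he hrel hXf hXg
  have swapped (hXg : ¬ MvPolynomial.X 1 ∣ g) (hXf : MvPolynomial.X 1 ∣ f ∨ e ≤ m) :=
    exists_hasJordanType_of_not_dvd hg hf he hm hrel.symm hXg hXf
  rw [Ideal.span_pair_comm] at swapped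
  by_cases h1 : MvPolynomial.X 1 ∣ f <;> by_cases h2 : MvPolynomial.X 1 ∣ g
  · exact absurd (hrel h1 h2) MvPolynomial.X_prime.not_isUnit
  · obtain ⟨S, h⟩ := swapped h2 (Or.inl h1)
    exact ⟨S, e, m, he, hm, h⟩
  · obtain ⟨S, h⟩ := direct h1 (Or.inl h2)
    exact ⟨S, m, e, hm, he, h⟩
  · rcases le_total m e with h | h
    · obtain ⟨S, h⟩ := direct h1 (Or.inr h)
      exact ⟨S, m, e, hm, he, h⟩
    · obtain ⟨S, h⟩ := swapped h2 (Or.inr h)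
      exact ⟨S, e, m, he, hm, h⟩

end NormalForm

/-! ### Reduction to ℓ = y and classification of the Jordan types. -/

section CoordinateChange

open MvPolynomial

variable {K : Type*} [Field K]

theorem exists_algEquiv_of_linearForm {l : MvPolynomial (Fin 2) K} (hl : l.IsHomogeneous 1)
    (hl0 : l ≠ 0) : ∃ τ : MvPolynomial (Fin 2) K ≃ₐ[K] MvPolynomial (Fin 2) K, τ l = X 1 ∧
      ∀ f n, f.IsHomogeneous n → (τ f).IsHomogeneous n := by
  obtain ⟨a, b, rfl⟩ : ∃ a b : K, l = C a * X 0 + C b * X 1 := by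
    refine ⟨(dehomogenize l).coeff 1, (dehomogenize l).coeff 0, ?_⟩
    conv_lhs => rw [← homogenize_dehomogenize hl]
    rw [homogenize_eq_sum (natDegree_dehomogenize_le hl)]
    simp [Finset.sum_range_succ, smul_eq_C_mul, add_comm]
  have hX (i : Fin 2) : (X i : MvPolynomial (Fin 2) K).IsHomogeneous 1 := isHomogeneous_X K i
  have hhom : ∀ p : Fin 2 → MvPolynomial (Fin 2) K, (∀ i, (p i).IsHomogeneous 1) →
      ∀ (f : MvPolynomial (Fin 2) K) (n : ℕ), f.IsHomogeneous n → (aeval p f).IsHomogeneous n := by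
    intro p hp f n hf
    simpa using hf.aeval p hp
  by_cases hb : b = 0
  · subst hb
    have ha : a ≠ 0 := by rintro rfl; simp at hl0
    have ha' : (C a * C a⁻¹ : MvPolynomial (Fin 2) K) = 1 := by
      rw [← C_mul, mul_inv_cancel₀ ha, C_1]
    refine ⟨AlgEquiv.ofAlgHom (aeval ![C a⁻¹ * X 1, X 0]) (aeval ![X 1, C a * X 0]) ?_ ?_, ?_, ?_⟩
    · refine algHom_ext fun i => ?_
      fin_cases i
      · simp
      · simp [← mul_assoc, ha']
    · refine algHom_ext fun i => ?_
      fin_cases i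
      · simp [← mul_assoc, (mul_comm _ _).trans ha']
      · simp
    · simp [← mul_assoc, ha']
    · refine hhom _ fun i => ?_
      fin_cases i
      · exact (hX 1).C_mul _
      · exact hX 0
  · have hb' : (C b * C b⁻¹ : MvPolynomial (Fin 2) K) = 1 := by
      rw [← C_mul, mul_inv_cancel₀ hb, C_1]
    refine ⟨AlgEquiv.ofAlgHom (aeval ![X 0, C b⁻¹ * (X 1 - C a * X 0)])
      (aeval ![X 0, C a * X 0 + C b * X 1]) ?_ ?_, ?_, ?_⟩
    · refine algHom_ext fun i => ?_
      fin_cases i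
      · simp
      · simp [← mul_assoc, hb']
    · refine algHom_ext fun i => ?_
      fin_cases i
      · simp
      · simp [← mul_assoc, (mul_comm _ _).trans hb']
    · simp [← mul_assoc, hb']
    · refine hhom _ fun i => ?_
      fin_cases i
      · exact hX 0
      · exact ((hX 1).sub ((hX 0).C_mul _)).C_mul _

theorem isRelPrime_map_equiv {R R' : Type*} [CommRing R] [CommRing R'] (τ : R ≃+* R') {f g : R}
    (h : IsRelPrime f g) : IsRelPrime (τ f) (τ g) := by
  intro c hcf hcg
  have h1 := map_dvd τ.symm hcf
  have h2 := map_dvd τ.symm hcg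
  rw [RingEquiv.symm_apply_apply] at h1 h2
  simpa using (h h1 h2).map τ

/-- The complete intersection Jordan types are the partitions `layeredDiagram S m e`. -/
theorem isCIJT_iff {P : YoungDiagram} : IsCIJT K P ↔ ∃ (S : Finset ℕ) (m e : ℕ), 0 < m ∧ 0 < e ∧
    (∀ t ∈ S, 0 < t ∧ t < m ∧ t < e) ∧ P = layeredDiagram S m e := by
  constructor
  · rintro ⟨I, l, hI, hl, hl0, hP⟩
    obtain ⟨f, g, m, e, hf, hg, hm, he, hrel, rfl⟩ := isGradedCompleteIntersection_iff.1 hI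
    obtain ⟨τ, hτ, hhom⟩ := exists_algEquiv_of_linearForm hl hl0
    obtain ⟨S, m', e', hm', he', hS, hJ⟩ := exists_hasJordanType_of_isRelPrime (hhom f m hf)
      (hhom g e hg) hm he (isRelPrime_map_equiv τ.toRingEquiv hrel)
    refine ⟨S, m', e', hm', he', hS, HasJordanType.unique (hP.congr (Ideal.quotientEquivAlg
      (Ideal.span {f, g}) (Ideal.span {τ f, τ g}) τ ?_).toLinearEquiv fun x => ?_) hJ⟩
    · rw [Ideal.map_span, Set.image_pair]
      rfl
    · obtain ⟨x, rfl⟩ := Ideal.Quotient.mk_surjective x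
      simp only [LinearMap.mulLeft_apply, AlgEquiv.toLinearEquiv_apply, ← map_mul,
        Ideal.quotientEquivAlg_mk, ← hτ]
  · rintro ⟨S, m, e, hm, he, hS, rfl⟩
    obtain ⟨φ, γ, rfl, h⟩ := exists_polynomials_of_degrees K S (fun t ht => (hS t ht).1) m hm
      fun t ht => (hS t ht).2.1
    -- The degree of γ is 0 or an element of S, so homogenizing γ in degree e makes sense.
    have hγ : γ.natDegree < e := by
      rcases h.natDegree_mem with h0 | h0
      · omega
      · exact (hS _ h0).2.2
    have hφ0 : φ ≠ 0 := by rintro rfl; simp at hm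
    refine ⟨Ideal.span {φ.homogenize φ.natDegree, γ.homogenize e}, X 1,
      isGradedCompleteIntersection_iff.2 ⟨_, _, _, _, Polynomial.isHomogeneous_homogenize φ,
        Polynomial.isHomogeneous_homogenize γ, hm, he,
        isRelPrime_homogenize hφ0 hγ.le h.isCoprime, rfl⟩, isHomogeneous_X K 1, X_ne_zero 1, ?_⟩
    have hφ := dehomogenize_homogenize (le_refl φ.natDegree)
    refine hasJordanType_layeredDiagram (Polynomial.isHomogeneous_homogenize φ)
      (Polynomial.isHomogeneous_homogenize γ) (by rw [hφ]) (fun t ht => (hS t ht).2.2) he ?_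
    rwa [hφ, dehomogenize_homogenize hγ.le]

end CoordinateChange

/-! ### Counting the layered diagrams. -/

section Counting

/-- The number of rows gives m, and the positions where the row length drops give S. -/
theorem layeredDiagram_injective {S S' : Finset ℕ} {m m' e e' : ℕ} (he : 0 < e) (he' : 0 < e')
    (hS : ∀ t ∈ S, 0 < t ∧ t < m ∧ t < e) (hS' : ∀ t ∈ S', 0 < t ∧ t < m' ∧ t < e')
    (h : layeredDiagram S m e = layeredDiagram S' m' e') : S = S' ∧ m = m' := by
  have hSe := fun t ht => (hS t ht).2.2
  have hSe' := fun t ht => (hS' t ht).2.2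
  have hm : m = m' := by
    have key : ∀ i, i < m ↔ i < m' := fun i => by
      rw [← rows_layeredDiagram he hSe, ← rows_layeredDiagram he' hSe', h]
    have h1 := key m
    have h2 := key m'
    omega
  subst hm
  refine ⟨?_, rfl⟩
  have key : ∀ i, i + 1 < m → (i + 1 ∈ S ↔ i + 1 ∈ S') := fun i hi => by
    rw [mem_iff_layeredDiagram_descent he hSe hi, mem_iff_layeredDiagram_descent he' hSe' hi, h]
  ext t
  constructor
  · intro ht
    obtain ⟨h1, h2, -⟩ := hS t ht
    obtain ⟨i, rfl⟩ := Nat.exists_eq_add_of_lt h1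
    rw [zero_add] at *
    exact (key i h2).1 ht
  · intro ht
    obtain ⟨h1, h2, -⟩ := hS' t ht
    obtain ⟨i, rfl⟩ := Nat.exists_eq_add_of_lt h1
    rw [zero_add] at *
    exact (key i h2).2 ht

/-- The diagrams are parametrized by S ⊆ {1, ..., d - 1} and m ∈ {d, d + k - 1}, with e = 2d + k - 1
- m. The two values of m coincide exactly when k = 1. -/
theorem ncard_isCIJT (K : Type*) [Field K] {d k : ℕ} (hd : 1 ≤ d) (hk : 1 ≤ k) :
    {P : YoungDiagram | diagonalLengths P = ciHilbertFunction d k ∧ IsCIJT K P}.ncard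
      = 2 ^ (d - 1) * ({d, d + k - 1} : Finset ℕ).card := by
  have hset : {P : YoungDiagram | diagonalLengths P = ciHilbertFunction d k ∧ IsCIJT K P} =
      (fun x : Finset ℕ × ℕ => layeredDiagram x.1 x.2 (2 * d + k - 1 - x.2)) ''
        ((Finset.Ico 1 d).powerset ×ˢ ({d, d + k - 1} : Finset ℕ) : Finset (Finset ℕ × ℕ)) := by
    ext P
    simp only [Set.mem_ofPred_eq, isCIJT_iff, Set.mem_image, Finset.mem_coe, Finset.mem_product,
      Finset.mem_powerset, Finset.mem_insert, Finset.mem_singleton, Prod.exists]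
    constructor
    · rintro ⟨hT, S, m, e, hm, he, hS, rfl⟩
      rw [diagonalLengths_layeredDiagram_eq_iff hd hk he fun t ht => (hS t ht).2.2] at hT
      refine ⟨S, m, ⟨fun t ht => ?_, by omega⟩, ?_⟩
      · have := hS t ht
        rw [Finset.mem_Ico]
        omega
      · congr 1
        omega
    · rintro ⟨S, m, ⟨hS, hm⟩, rfl⟩
      have hS' : ∀ t ∈ S, 0 < t ∧ t < m ∧ t < 2 * d + k - 1 - m := fun t ht => by
        have := Finset.mem_Ico.1 (hS ht)
        omega
      refine ⟨(diagonalLengths_layeredDiagram_eq_iff hd hk (by omega)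
        fun t ht => (hS' t ht).2.2).2 (by omega), S, m, _, by omega, by omega, hS', rfl⟩
  rw [hset, Set.InjOn.ncard_image, Set.ncard_coe_finset, Finset.card_product, Finset.card_powerset,
    Nat.card_Ico]
  rintro ⟨S, m⟩ h ⟨S', m'⟩ h' heq
  simp only [Finset.mem_coe, Finset.mem_product, Finset.mem_powerset, Finset.mem_insert,
    Finset.mem_singleton] at h h'
  obtain ⟨rfl, rfl⟩ := layeredDiagram_injective (by omega) (by omega)
    (fun t ht => by have := Finset.mem_Ico.1 (h.1 ht); omega)
    (fun t ht => by have := Finset.mem_Ico.1 (h'.1 ht); omega) heq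
  rfl

end Counting

theorem corollary3p10 (K : Type*) [Field K] (d k : ℕ) (hd : 1 ≤ d) (hk : 1 ≤ k)
    (hchar : ringChar K = 0 ∨ 2 * d + k - 3 < ringChar K) :
    (1 < k → {P : YoungDiagram | diagonalLengths P = ciHilbertFunction d k ∧ IsCIJT K P}.ncard
      = 2 ^ d) ∧
    (k = 1 → {P : YoungDiagram | diagonalLengths P = ciHilbertFunction d k ∧ IsCIJT K P}.ncard
      = 2 ^ (d - 1)) := by
  rw [ncard_isCIJT K hd hk]
  constructor
  · intro h
    rw [Finset.card_pair (by omega), ← pow_succ, Nat.sub_add_cancel hd]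
  · rintro rfl
    simp
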